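/- For $m\ge 1$ let $\mathcal P_m=\{\lambda=(\lambda_1,\dots,\lambda_m)\in\mathbb N^m:\lambda_1\ge\cdots\ge\lambda_m\ge 0\}$, where $\mathbb N=\{0,1,2,\dots\}$. For $\lambda\in\mathcal P_m$ and $n\in\mathbb N$ let $$g_\lambda(x_1,\dots,x_n)=\sum_{\pi}\prod_{i=1}^n x_i^{c_i(\pi)}$$ be the dual Grothendieck polynomial, where the sum runs over all plane partitions $\pi$ (matrices $(\pi_{ij})_{i,j\ge1}$ of nonnegative integers with finitely many nonzero entries, weakly decreasing along rows and down columns) of shape $\{(i,j):\pi_{ij}>0\}=\{(i,j):1\le i\le m,\ 1\le j\le\lambda_i\}$ with all entries at most $n$, and $c_i(\pi)$ is the number of columns of $\pi$ containing $i$. Let $s_\mu$ denote the Schur polynomial, the generating function of semistandard Young tableaux of shape $\mu$; let $(a^p)=(a,\dots,a)$ be the partition with $p$ parts equal to $a$, and let $1^p$ stand for $p$ arguments equal to $1$. **Theorem.** Let $1\le k\le m$, $a\in\mathbb N$, $n\in\mathbb N$ and $q_1,\dots,q_n\in(0,1)$. Then the series below converges and $$\sum_{\lambda\in\mathcal P_m,\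 \lambda_k\le a} g_\lambda(q_1,\dots,q_n)=\prod_{i=1}^n(1-q_i)^{1-k}\; s_{(a^{m-k+1})}(1^{m-k+1},q_1,\dots,q_n).$$ -/

import Mathlib

namespace DualGroth

/-- A plane partition: a matrix of nonnegative integers (indexed from `0`) with finitely many
nonzero entries, weakly decreasing along rows and down columns. -/
@[ext]
structure PlanePartition where
  entry : ℕ → ℕ → ℕ
  finite_support : {c : ℕ × ℕ | entry c.1 c.2 ≠ 0}.Finite
  col_le : ∀ i j, entry (i + 1) j ≤ entry i j
  row_le : ∀ i j, entry i (j + 1) ≤ entry i j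

/-- The shape: the set of positions of the positive entries. -/
def PlanePartition.shape (π : PlanePartition) : Set (ℕ × ℕ) :=
  {c | 0 < π.entry c.1 c.2}

/-- The number of columns of `π` containing the entry `v` (used for `v ≥ 1` only). -/
noncomputable def PlanePartition.columnCount (π : PlanePartition) (v : ℕ) : ℕ :=
  {j : ℕ | ∃ i, π.entry i j = v}.ncard

/-- Plane partitions of shape `μ` with largest entry at most `n`. -/
abbrev PlanePartitionOfShape (μ : YoungDiagram) (n : ℕ) : Type :=
  {π : PlanePartition // π.shape = (μ : Set (ℕ × ℕ)) ∧ ∀ i j, π.entry i j ≤ n}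

instance (μ : YoungDiagram) (n : ℕ) : Finite (PlanePartitionOfShape μ n) := by
  let f : PlanePartitionOfShape μ n → (μ.cells → Fin (n + 1)) :=
    fun π c => ⟨π.1.entry c.1.1 c.1.2, Nat.lt_succ_of_le (π.2.2 _ _)⟩
  refine Finite.of_injective f ?_
  intro π ρ h
  refine Subtype.ext (PlanePartition.ext ?_)
  funext i j
  by_cases hc : (i, j) ∈ μ.cells
  · exact congrArg Fin.val (congrFun h ⟨(i, j), hc⟩)
  · have key : ∀ τ : PlanePartitionOfShape μ n, τ.1.entry i j = 0 := by
      intro τ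
      by_contra hne
      have hmem : (i, j) ∈ τ.1.shape := Nat.pos_of_ne_zero hne
      rw [τ.2.1] at hmem
      exact hc hmem
    rw [key π, key ρ]

noncomputable instance (μ : YoungDiagram) (n : ℕ) : Fintype (PlanePartitionOfShape μ n) :=
  Fintype.ofFinite _

/-- The dual Grothendieck polynomial `g_μ(x_1, …, x_n)`; the variable `X i` (`i = 0, …, n - 1`)
stands for `x_{i+1}`, so it records the number of columns containing the entry `i + 1`. -/
noncomputable def dualGrothendieck (μ : YoungDiagram) (n : ℕ) : MvPolynomial (Fin n) ℤ :=
  ∑ π : PlanePartitionOfShape μ n,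
    ∏ i : Fin n, MvPolynomial.X i ^ π.1.columnCount ((i : ℕ) + 1)

/-- Semistandard Young tableaux of shape `μ` in the alphabet `{0, …, N - 1}`. -/
abbrev BoundedTableau (μ : YoungDiagram) (N : ℕ) : Type :=
  {T : SemistandardYoungTableau μ // ∀ c ∈ μ.cells, T c.1 c.2 < N}

instance (μ : YoungDiagram) (N : ℕ) : Finite (BoundedTableau μ N) := by
  let f : BoundedTableau μ N → (μ.cells → Fin N) :=
    fun T c => ⟨T.1 c.1.1 c.1.2, T.2 c.1 c.2⟩
  refine Finite.of_injective f ?_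
  intro T S h
  refine Subtype.ext (SemistandardYoungTableau.ext ?_)
  intro i j
  by_cases hc : (i, j) ∈ μ.cells
  · exact congrArg Fin.val (congrFun h ⟨(i, j), hc⟩)
  · rw [T.1.zeros hc, S.1.zeros hc]

noncomputable instance (μ : YoungDiagram) (N : ℕ) : Fintype (BoundedTableau μ N) :=
  Fintype.ofFinite _

/-- The Schur polynomial `s_μ(x_1, …, x_N)`; the variable `X i` (`i = 0, …, N - 1`)
stands for `x_{i+1}`. -/
noncomputable def schur (μ : YoungDiagram) (N : ℕ) : MvPolynomial (Fin N) ℤ :=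
  ∑ T : BoundedTableau μ N,
    ∏ c : μ.cells, MvPolynomial.X (⟨T.1 c.1.1 c.1.2, T.2 c.1 c.2⟩ : Fin N)

/-- Integer partitions with at most `m` parts: sequences `l 0 ≥ l 1 ≥ ⋯ ≥ l (m - 1) ≥ 0`. -/
abbrev Partitions (m : ℕ) : Type := {l : Fin m → ℕ // Antitone l}

/-- The Young diagram `{(i, j) : j < l i}` of a partition. -/
def Partitions.diagram {m : ℕ} (l : Partitions m) : YoungDiagram :=
  YoungDiagram.ofRowLens (List.ofFn l.1) (List.sortedGE_ofFn_iff.mpr l.2)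

/-- The partition `(a^p) = (a, …, a)` with `p` parts equal to `a`. -/
def rect (p a : ℕ) : Partitions p := ⟨fun _ => a, fun _ _ _ => le_rfl⟩

end DualGroth

/-!
Reading a plane partition through its level sets `{π ≥ 1} ⊇ {π ≥ 2} ⊇ ⋯` turns `g_l(q)` into the
weight of a chain of partitions in which a step from `m` to `l ⊇ m` weighs `x ^ c`, with `c` the
number of columns meeting `l / m` (`dualEval_succ`). Row by row, such a step reads
`l i = max (m i) (l (i + 1)) + w i` with arbitrary `w i ≥ 0` and `c = ∑ w i`: this is last-passage
percolation with geometric weights (`lppStep_eq_tsum`). Hence `∑ g_l(q) f(l)` is an iterated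
percolation operator applied to `f` and evaluated at the empty partition (`tsum_dualEval`).

The rows `k, …, m` evolve without regard to the rows above them. If `f` does not depend on the first
row, that row only contributes a geometric series `∏ (1 - q_i)⁻¹` (`lppIter_tail`), so the condition
`l_k ≤ a` on `m` rows reduces to the condition `l_1 ≤ a` on `m - k + 1` rows, at the cost of the
factor `∏ (1 - q_i) ^ (1 - k)`.

For the condition `l_1 ≤ a`, percolation is compared with the addition of horizontal strips, the
transition that generates Schur polynomials. Summation over Gelfand–Tsetlin patterns intertwines the
two (`gtSum_lppStep`); by induction on the number of rows this comes down to the toggle involution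
underlying the Robinson–Schensted–Knuth correspondence (`local_rule`). The sum thereby becomes a sum
over chains of horizontal strips from the empty partition to some `l` with `l_1 ≤ a`, followed by a
Gelfand–Tsetlin pattern with top row `l`. Passing to complements in the rectangle (`boxSchur`),
these are the semistandard tableaux of rectangular shape, by the branching rule of Schur polynomials
(`schurEval_succ`): the pattern accounts for the letters of weight `1` and the strips for the
letters of weight `q_i`.

All sums are taken in `ℝ≥0∞`, where they may be interchanged freely; convergence follows at the end
from the finiteness of the right-hand side.
-/

open scoped ENNReal
namespace DualGroth

/-! ### Interlacing sequences -/

/-- The extension by zero of a finite sequence. -/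
def pad {p : ℕ} (l : Fin p → ℕ) (i : ℕ) : ℕ := if h : i < p then l ⟨i, h⟩ else 0

/-- `u ≺ v`: the interlacing condition `v 0 ≥ u 0 ≥ v 1 ≥ u 1 ≥ ⋯`, that is, `v / u` is a
horizontal strip. -/
def Interlaces (u v : ℕ → ℕ) : Prop := ∀ i, v (i + 1) ≤ u i ∧ u i ≤ v i

@[simp] lemma pad_coe {p : ℕ} (l : Fin p → ℕ) (i : Fin p) : pad l i = l i := by
  simp [pad]

lemma pad_of_le {p : ℕ} (l : Fin p → ℕ) {i : ℕ} (h : p ≤ i) : pad l i = 0 := by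
  simp [pad, h]

@[simp] lemma pad_cons_zero {p : ℕ} (c : ℕ) (l : Fin p → ℕ) :
    pad (Fin.cons c l : Fin (p + 1) → ℕ) 0 = c := by
  simp [pad]

@[simp] lemma pad_cons_succ {p : ℕ} (c : ℕ) (l : Fin p → ℕ) (i : ℕ) :
    pad (Fin.cons c l : Fin (p + 1) → ℕ) (i + 1) = pad l i := by
  by_cases h : i < p
  · rw [pad, pad, dif_pos (by omega), dif_pos h]
    exact Fin.cons_succ (α := fun _ => ℕ) c l ⟨i, h⟩
  · rw [pad_of_le _ (by omega), pad_of_le _ (by omega)]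

lemma pad_tail {p : ℕ} (l : Fin (p + 1) → ℕ) (i : ℕ) : pad (Fin.tail l) i = pad l (i + 1) := by
  conv_rhs => rw [← Fin.cons_self_tail l]
  rw [pad_cons_succ]

lemma pad_zero_eq {p : ℕ} (l : Fin (p + 1) → ℕ) : pad l 0 = l 0 := by
  simp [pad]

lemma sum_range_pad {p : ℕ} (l : Fin p → ℕ) : ∑ i ∈ Finset.range p, pad l i = ∑ i, l i := by
  rw [← Fin.sum_univ_eq_sum_range]; simp

/-! ### Percolation, horizontal strips and Gelfand–Tsetlin patterns -/

/-- One step of last-passage percolation with geometric weights: the sum over all `w` of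
`x ^ ∑ w i * f l`, where `l` is determined from the last entry to the first by
`l i = max (m i) (l (i + 1)) + w i`, with `l p = 0`. -/
noncomputable def lppStep (x : ℝ≥0∞) : (p : ℕ) → ((Fin p → ℕ) → ℝ≥0∞) → (Fin p → ℕ) → ℝ≥0∞
  | 0, f => f
  | p + 1, f => fun m => lppStep x p
      (fun l => ∑' w, x ^ w * f (Fin.cons (max (m 0) (pad l 0) + w) l)) (Fin.tail m)

open Classical in
/-- The operator adding a horizontal strip: each `l` for which `l / m` is a horizontal strip weighs
`x ^ |l / m|`. The subtraction of naturals is exact, as `m ≤ l` whenever the two interlace. -/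
noncomputable def stripStep (x : ℝ≥0∞) (p : ℕ) (f : (Fin p → ℕ) → ℝ≥0∞) (m : Fin p → ℕ) : ℝ≥0∞ :=
  ∑' l : Fin p → ℕ, if Interlaces (pad m) (pad l) then x ^ (∑ i, l i - ∑ i, m i) * f l else 0

open Classical in
/-- The sum of `f` over the Gelfand–Tsetlin patterns with top row `l`; here `f` is evaluated at the
sequence of first (largest) entries of the rows of the pattern, from the top row to the bottom
row. -/
noncomputable def gtSum : (p : ℕ) → ((Fin p → ℕ) → ℝ≥0∞) → (Fin p → ℕ) → ℝ≥0∞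
  | 0, f => f
  | p + 1, f => fun l => ∑' u : Fin p → ℕ,
      if Interlaces (pad u) (pad l) then gtSum p (fun r => f (Fin.cons (l 0) r)) u else 0

/-! ### The local rule and the intertwining relation -/

lemma tsum_ge_eq_tsum_add (M : ℕ) (h : ℕ → ℝ≥0∞) :
    ∑' c, (if M ≤ c then h c else 0) = ∑' w, h (M + w) := by
  rw [← (add_right_injective M).tsum_eq (f := fun c => if M ≤ c then h c else 0)]
  · simp
  · intro c hc
    by_contra hn
    refine hc (if_neg fun hM => ?_)
    exact hn ⟨c - M, by simp; omega⟩

lemma tsum_fin_succ {p : ℕ} (F : (Fin (p + 1) → ℕ) → ℝ≥0∞) :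
    ∑' l, F l = ∑' r : Fin p → ℕ, ∑' c : ℕ, F (Fin.cons c r) := by
  rw [← (Fin.consEquiv (fun _ : Fin (p + 1) => ℕ)).tsum_eq F, ENNReal.tsum_prod', ENNReal.tsum_comm]
  rfl

open Classical in
/-- A sum over the box `∏ [lo i, hi i]` is invariant under the central reflection of the box. -/
lemma tsum_box_reflect {p : ℕ} (lo hi : Fin p → ℕ) (F : (Fin p → ℕ) → ℝ≥0∞)
    (hF : ∀ u, ¬ (∀ i, lo i ≤ u i ∧ u i ≤ hi i) → F u = 0) :
    ∑' u, F u = ∑' u : Fin p → ℕ,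
      if ∀ i, lo i ≤ u i ∧ u i ≤ hi i then F (fun i => lo i + hi i - u i) else 0 := by
  let σ : (Fin p → ℕ) → (Fin p → ℕ) := fun u i =>
    if lo i ≤ u i ∧ u i ≤ hi i then lo i + hi i - u i else u i
  have hσ : Function.Involutive σ := by
    intro u
    funext i
    simp only [σ]
    split_ifs <;> omega
  rw [← hσ.toPerm.tsum_eq F]
  refine tsum_congr fun u => ?_
  simp only [Function.Involutive.coe_toPerm]
  split_ifs with h
  · congr 1
    funext i
    simp [σ, h i]
  · apply hF
    intro h2
    apply h
    intro i
    have := h2 i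
    simp only [σ] at this
    split_ifs at this <;> omega

lemma interlaces_cons_iff {p : ℕ} (m : Fin (p + 1) → ℕ) (c : ℕ) (r : Fin p → ℕ) :
    Interlaces (pad m) (pad (Fin.cons c r : Fin (p + 1) → ℕ)) ↔
      m 0 ≤ c ∧ ∀ i : Fin p, pad m (i + 1) ≤ r i ∧ r i ≤ pad m i := by
  constructor
  · intro h
    refine ⟨by simpa [pad_zero_eq] using (h 0).2, fun i => ⟨?_, ?_⟩⟩
    · simpa using (h (i + 1)).2
    · simpa using (h i).1
  · rintro ⟨h0, h⟩ i
    rw [pad_cons_succ]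
    have hle : pad r i ≤ pad m i := by
      by_cases hi : i < p
      · simpa using (h ⟨i, hi⟩).2.trans' (by simp [pad, hi])
      · simp [pad_of_le r (not_lt.mp hi)]
    refine ⟨hle, ?_⟩
    cases i with
    | zero => simpa [pad_zero_eq] using h0
    | succ i =>
      rw [pad_cons_succ]
      by_cases hi : i < p
      · simpa [pad, hi] using (h ⟨i, hi⟩).1
      · rw [pad_of_le m (by omega)]; omega

/-- The variant of `interlaces_cons_iff` in which the lower sequence is one entry shorter. -/
lemma interlaces_cons_iff' {p : ℕ} (m : Fin p → ℕ) (c : ℕ) (r : Fin p → ℕ) :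
    Interlaces (pad m) (pad (Fin.cons c r : Fin (p + 1) → ℕ)) ↔
      pad m 0 ≤ c ∧ ∀ i : Fin p, pad m (i + 1) ≤ r i ∧ r i ≤ m i := by
  constructor
  · intro h
    refine ⟨by simpa using (h 0).2, fun i => ⟨?_, ?_⟩⟩
    · simpa using (h (i + 1)).2
    · simpa using (h i).1
  · rintro ⟨h0, h⟩ i
    rw [pad_cons_succ]
    constructor
    · by_cases hi : i < p
      · simpa [pad, hi] using (h ⟨i, hi⟩).2
      · simp [pad_of_le r (not_lt.mp hi)]
    · cases i with
      | zero => simpa using h0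
      | succ i =>
        rw [pad_cons_succ]
        by_cases hi : i < p
        · simpa [pad, hi] using (h ⟨i, hi⟩).1
        · rw [pad_of_le m (by omega)]; omega

/-- When the upper sequence is at most one entry longer, interlacing is a condition on the entries
of the lower sequence only. -/
lemma interlaces_iff_of_le {p q : ℕ} (hq : q ≤ p + 1) (u : Fin p → ℕ) (m : Fin q → ℕ) :
    Interlaces (pad u) (pad m) ↔ ∀ i : Fin p, pad m (i + 1) ≤ u i ∧ u i ≤ pad m i := by
  constructor
  · intro h i
    simpa using h i
  · intro h i
    by_cases hi : i < p
    · simpa [pad, hi] using h ⟨i, hi⟩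
    · rw [pad_of_le u (by omega), pad_of_le m (by omega)]; simp

open Classical in
/-- The local rule of the Robinson–Schensted–Knuth correspondence: for fixed `m` and `u'`, the
pairs `(u, w)` with `u ≺ m`, `u ≺ u'` and the sequences `l` with `m ≺ l`, `u' ≺ l` correspond
to each other by `l 0 = max (m 0) (u' 0) + w` and
`l (i + 1) = max (m (i + 1)) (u' (i + 1)) + min (m i) (u' i) - u i`. -/
lemma local_rule {p : ℕ} (x : ℝ≥0∞) (m : Fin (p + 1) → ℕ) (u' : Fin p → ℕ) (F : ℕ → ℝ≥0∞) :
    (∑' u : Fin p → ℕ, if Interlaces (pad u) (pad m) ∧ Interlaces (pad u) (pad u') then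
        x ^ (∑ i, u' i - ∑ i, u i) * ∑' w, x ^ w * F (max (m 0) (pad u' 0) + w) else 0) =
      ∑' l : Fin (p + 1) → ℕ, if Interlaces (pad m) (pad l) ∧ Interlaces (pad u') (pad l) then
        x ^ (∑ i, l i - ∑ i, m i) * F (l 0) else 0 := by
  set lo : Fin p → ℕ := fun i => max (pad m (i + 1)) (pad u' (i + 1)) with hlo
  set hi : Fin p → ℕ := fun i => min (pad m i) (u' i) with hhi
  -- The weights agree because `min + max` of the entries of `m` and `u'` adds up to their sum.
  have hsum : ∑ i, (lo i + hi i) + max (m 0) (pad u' 0) = ∑ i, u' i + ∑ i, m i := by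
    have h1 : ∑ i, lo i + max (m 0) (pad u' 0) =
        ∑ i ∈ Finset.range (p + 1), max (pad m i) (pad u' i) := by
      rw [Finset.sum_range_succ', ← Fin.sum_univ_eq_sum_range
        (fun i => max (pad m (i + 1)) (pad u' (i + 1))), pad_zero_eq]
    have h2 : ∑ i, hi i = ∑ i ∈ Finset.range (p + 1), min (pad m i) (pad u' i) := by
      rw [Finset.sum_range_succ, pad_of_le u' le_rfl, ← Fin.sum_univ_eq_sum_range
        (fun i => min (pad m i) (pad u' i))]
      simp [hhi]
    have h3 : ∑ i ∈ Finset.range (p + 1), pad u' i = ∑ i, u' i := by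
      rw [Finset.sum_range_succ, pad_of_le u' le_rfl, sum_range_pad, add_zero]
    rw [Finset.sum_add_distrib, add_right_comm, h1, h2, ← Finset.sum_add_distrib, ← h3,
      ← sum_range_pad m, ← Finset.sum_add_distrib]
    exact Finset.sum_congr rfl fun i _ => by omega
  -- Both interlacing conditions confine the free entries to the same box.
  have hL : ∀ u : Fin p → ℕ, (Interlaces (pad u) (pad m) ∧ Interlaces (pad u) (pad u')) ↔
      ∀ i, lo i ≤ u i ∧ u i ≤ hi i := by
    intro u
    rw [interlaces_iff_of_le le_rfl, interlaces_iff_of_le (by omega), ← forall_and]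
    refine forall_congr' fun i => ?_
    simp only [hlo, hhi, pad_coe]
    omega
  have hR : ∀ (c : ℕ) (r : Fin p → ℕ),
      (Interlaces (pad m) (pad (Fin.cons c r : Fin (p + 1) → ℕ)) ∧
        Interlaces (pad u') (pad (Fin.cons c r : Fin (p + 1) → ℕ))) ↔
      max (m 0) (pad u' 0) ≤ c ∧ ∀ i, lo i ≤ r i ∧ r i ≤ hi i := by
    intro c r
    rw [interlaces_cons_iff, interlaces_cons_iff', and_and_and_comm, ← forall_and, max_le_iff]
    refine and_congr Iff.rfl (forall_congr' fun i => ?_)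
    simp only [hlo, hhi]
    omega
  simp only [hL]
  rw [tsum_fin_succ, tsum_box_reflect lo hi]
  swap
  · intro u hu
    rw [if_neg hu]
  refine tsum_congr fun r => ?_
  simp only [hR]
  by_cases hr : ∀ i, lo i ≤ r i ∧ r i ≤ hi i
  · have hr' : ∀ i, lo i ≤ lo i + hi i - r i ∧ lo i + hi i - r i ≤ hi i := by
      intro i; have := hr i; omega
    simp only [hr', hr, implies_true, if_true, and_true]
    rw [tsum_ge_eq_tsum_add (max (m 0) (pad u' 0))
      (fun c => x ^ (∑ i, (Fin.cons c r : Fin (p + 1) → ℕ) i - ∑ i, m i) *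
        F ((Fin.cons c r : Fin (p + 1) → ℕ) 0)), ← ENNReal.tsum_mul_left]
    refine tsum_congr fun w => ?_
    rw [← mul_assoc, ← pow_add, Fin.sum_cons, Fin.cons_zero]
    congr 2
    have h4 : ∑ i, (lo i + hi i - r i) + ∑ i, r i = ∑ i, (lo i + hi i) := by
      rw [← Finset.sum_add_distrib]
      exact Finset.sum_congr rfl fun i _ => by have := hr i; omega
    have h5 : ∑ i, (lo i + hi i - r i) ≤ ∑ i, u' i := by
      refine Finset.sum_le_sum fun i _ => ?_
      have := hr' i
      simp only [hhi] at this ⊢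
      omega
    omega
  · simp [hr]

lemma gtSum_tsum {ι : Type*} (p : ℕ) (f : ι → (Fin p → ℕ) → ℝ≥0∞) (l : Fin p → ℕ) :
    gtSum p (fun r => ∑' i, f i r) l = ∑' i, gtSum p (f i) l := by
  induction p with
  | zero => rfl
  | succ p ih =>
    simp only [gtSum, ih]
    rw [ENNReal.tsum_comm]
    refine tsum_congr fun u => ?_
    split_ifs <;> simp

lemma gtSum_const_mul (p : ℕ) (c : ℝ≥0∞) (f : (Fin p → ℕ) → ℝ≥0∞) (l : Fin p → ℕ) :
    gtSum p (fun r => c * f r) l = c * gtSum p f l := by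
  induction p with
  | zero => rfl
  | succ p ih =>
    simp only [gtSum, ih]
    rw [← ENNReal.tsum_mul_left]
    refine tsum_congr fun u => ?_
    split_ifs <;> simp

/-- The first entry of the top row of a Gelfand–Tsetlin pattern is determined by that row. -/
lemma gtSum_pad_zero (p : ℕ) (f : ℕ → (Fin p → ℕ) → ℝ≥0∞) (l : Fin p → ℕ) :
    gtSum p (fun r => f (pad r 0) r) l = gtSum p (f (pad l 0)) l := by
  cases p with
  | zero => rfl
  | succ p => simp [gtSum, pad_zero_eq]

/-- Last-passage percolation and addition of horizontal strips are intertwined by the sum over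
Gelfand–Tsetlin patterns. -/
theorem gtSum_lppStep (x : ℝ≥0∞) (p : ℕ) (f : (Fin p → ℕ) → ℝ≥0∞) (m : Fin p → ℕ) :
    gtSum p (lppStep x p f) m = stripStep x p (gtSum p f) m := by
  classical
  induction p with
  | zero =>
    rw [stripStep, tsum_eq_single m (fun b hb => absurd (Subsingleton.elim b m) hb)]
    have : Interlaces (pad m) (pad m) := fun i => by simp [pad]
    simp [this, gtSum, lppStep]
  | succ p ih =>
    -- The top row enters through the first entry of the row below it, which is fixed by `u'`.
    have hK : ∀ u' : Fin p → ℕ, gtSum p (fun l : Fin p → ℕ =>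
        ∑' w, x ^ w * f (Fin.cons (max (m 0) (pad l 0) + w) l)) u' =
        ∑' w, x ^ w * gtSum p (fun l => f (Fin.cons (max (m 0) (pad u' 0) + w) l)) u' := by
      intro u'
      rw [gtSum_pad_zero p (fun c l => ∑' w, x ^ w * f (Fin.cons (max (m 0) c + w) l)),
        gtSum_tsum]
      simp only [gtSum_const_mul]
    calc gtSum (p + 1) (lppStep x (p + 1) f) m
        = ∑' u : Fin p → ℕ, ∑' u' : Fin p → ℕ,
            if Interlaces (pad u) (pad m) ∧ Interlaces (pad u) (pad u') then
              x ^ (∑ i, u' i - ∑ i, u i) * ∑' w, x ^ w *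
                gtSum p (fun l => f (Fin.cons (max (m 0) (pad u' 0) + w) l)) u' else 0 := by
          simp only [gtSum, lppStep, Fin.cons_zero, Fin.tail_cons, ih]
          refine tsum_congr fun u => ?_
          by_cases hu : Interlaces (pad u) (pad m)
          · simp only [hu, if_true, true_and, stripStep, hK]
          · simp [hu]
      _ = ∑' u' : Fin p → ℕ, ∑' l : Fin (p + 1) → ℕ,
            if Interlaces (pad m) (pad l) ∧ Interlaces (pad u') (pad l) then
              x ^ (∑ i, l i - ∑ i, m i) * gtSum p (fun r => f (Fin.cons (l 0) r)) u' else 0 := by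
          rw [ENNReal.tsum_comm]
          refine tsum_congr fun u' => ?_
          exact local_rule x m u' (fun c => gtSum p (fun l => f (Fin.cons c l)) u')
      _ = stripStep x (p + 1) (gtSum (p + 1) f) m := by
          rw [ENNReal.tsum_comm, stripStep]
          refine tsum_congr fun l => ?_
          by_cases hl : Interlaces (pad m) (pad l)
          · simp only [hl, if_true, true_and, gtSum]
            rw [← ENNReal.tsum_mul_left]
            refine tsum_congr fun u' => ?_
            split_ifs <;> simp
          · simp [hl]

/-- The only Gelfand–Tsetlin pattern with top row `0` is the zero pattern. -/
lemma gtSum_zero (p : ℕ) (f : (Fin p → ℕ) → ℝ≥0∞) : gtSum p f 0 = f 0 := by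
  induction p with
  | zero => rfl
  | succ p ih =>
    simp only [gtSum]
    rw [tsum_eq_single 0]
    · have h : Interlaces (pad (0 : Fin p → ℕ)) (pad (0 : Fin (p + 1) → ℕ)) :=
        fun i => by simp [pad]
      rw [if_pos h, ih]
      congr 1
      funext i
      cases i using Fin.cases <;> simp
    · intro u hu
      rw [if_neg]
      intro h
      apply hu
      funext i
      have := (h i).2
      simpa [pad] using this

lemma lppStep_const_mul (x : ℝ≥0∞) (p : ℕ) (c : ℝ≥0∞) (f : (Fin p → ℕ) → ℝ≥0∞) (m : Fin p → ℕ) :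
    lppStep x p (fun l => c * f l) m = c * lppStep x p f m := by
  induction p with
  | zero => rfl
  | succ p ih =>
    simp only [lppStep, ← ih]
    congr 1
    funext l
    rw [← ENNReal.tsum_mul_left]
    exact tsum_congr fun w => by ring

/-- If `f` depends on `r ↦ tail r` only, the top row of the percolation splits off as a geometric
series. -/
lemma lppStep_tail (x : ℝ≥0∞) (p : ℕ) (f : (Fin p → ℕ) → ℝ≥0∞) (m : Fin (p + 1) → ℕ) :
    lppStep x (p + 1) (fun l => f (Fin.tail l)) m = (1 - x)⁻¹ * lppStep x p f (Fin.tail m) := by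
  rw [← lppStep_const_mul]
  simp only [lppStep, Fin.tail_cons, ENNReal.tsum_mul_right, ENNReal.tsum_geometric]

/-- Iterated percolation steps; the parameter `x 0` belongs to the step that is taken last. -/
noncomputable def lppIter {p : ℕ} : (n : ℕ) → (ℕ → ℝ≥0∞) → ((Fin p → ℕ) → ℝ≥0∞) →
    (Fin p → ℕ) → ℝ≥0∞
  | 0, _, f => f
  | n + 1, x, f => lppIter n (fun i => x (i + 1)) (lppStep (x 0) p f)

/-- Iterated addition of horizontal strips; the parameter `x 0` belongs to the step that is taken
last. -/
noncomputable def stripIter {p : ℕ} : (n : ℕ) → (ℕ → ℝ≥0∞) → ((Fin p → ℕ) → ℝ≥0∞) →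
    (Fin p → ℕ) → ℝ≥0∞
  | 0, _, f => f
  | n + 1, x, f => stripIter n (fun i => x (i + 1)) (stripStep (x 0) p f)

lemma gtSum_lppIter {p : ℕ} (n : ℕ) (x : ℕ → ℝ≥0∞) (f : (Fin p → ℕ) → ℝ≥0∞) :
    gtSum p (lppIter n x f) = stripIter n x (gtSum p f) := by
  induction n generalizing x f with
  | zero => rfl
  | succ n ih =>
    rw [lppIter, stripIter, ih]
    congr 1
    funext m
    exact gtSum_lppStep _ _ _ _

lemma lppIter_zero_eq {p : ℕ} (n : ℕ) (x : ℕ → ℝ≥0∞) (f : (Fin p → ℕ) → ℝ≥0∞) :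
    lppIter n x f 0 = stripIter n x (gtSum p f) 0 := by
  rw [← gtSum_lppIter, gtSum_zero]

lemma lppIter_const_mul {p : ℕ} (n : ℕ) (x : ℕ → ℝ≥0∞) (c : ℝ≥0∞) (f : (Fin p → ℕ) → ℝ≥0∞)
    (m : Fin p → ℕ) : lppIter n x (fun l => c * f l) m = c * lppIter n x f m := by
  induction n generalizing x f with
  | zero => rfl
  | succ n ih =>
    have h : lppStep (x 0) p (fun l => c * f l) = fun l => c * lppStep (x 0) p f l := by
      funext l; exact lppStep_const_mul _ _ _ _ _
    rw [lppIter, lppIter, h, ih]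

lemma lppIter_tail {p : ℕ} (n : ℕ) (x : ℕ → ℝ≥0∞) (f : (Fin p → ℕ) → ℝ≥0∞)
    (m : Fin (p + 1) → ℕ) :
    lppIter n x (fun l : Fin (p + 1) → ℕ => f (Fin.tail l)) m =
      (∏ i ∈ Finset.range n, (1 - x i)⁻¹) * lppIter n x f (Fin.tail m) := by
  induction n generalizing x f with
  | zero => simp [lppIter]
  | succ n ih =>
    have h : lppStep (x 0) (p + 1) (fun l : Fin (p + 1) → ℕ => f (Fin.tail l)) =
        fun l => (1 - x 0)⁻¹ * lppStep (x 0) p f (Fin.tail l) := by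
      funext l; exact lppStep_tail _ _ _ _
    rw [lppIter, lppIter, h, ih _ (fun l => (1 - x 0)⁻¹ * lppStep (x 0) p f l),
      lppIter_const_mul,
      Finset.prod_range_succ', mul_assoc]

lemma Partitions.mem_diagram {p : ℕ} (l : Partitions p) (i j : ℕ) :
    (i, j) ∈ l.diagram ↔ j < pad l.1 i := by
  rw [Partitions.diagram, YoungDiagram.mem_ofRowLens]
  by_cases h : i < p <;> simp [pad, h]

lemma Partitions.rowLen_diagram {p : ℕ} (l : Partitions p) : l.diagram.rowLen = pad l.1 := by
  funext i
  refine eq_of_forall_lt_iff fun j => ?_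
  rw [← YoungDiagram.mem_iff_lt_rowLen, l.mem_diagram]

lemma pad_injective {p : ℕ} : Function.Injective (pad : (Fin p → ℕ) → ℕ → ℕ) := by
  intro l m h
  funext i
  rw [← pad_coe l, h, pad_coe]

lemma Partitions.diagram_injective {p : ℕ} :
    Function.Injective (Partitions.diagram : Partitions p → YoungDiagram) := by
  intro l m h
  exact Subtype.ext (pad_injective (by rw [← l.rowLen_diagram, h, m.rowLen_diagram]))

lemma youngDiagram_ext_rowLen {μ ν : YoungDiagram} (h : μ.rowLen = ν.rowLen) : μ = ν := by
  ext ⟨i, j⟩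
  rw [YoungDiagram.mem_cells, YoungDiagram.mem_cells, YoungDiagram.mem_iff_lt_rowLen, h,
    YoungDiagram.mem_iff_lt_rowLen]

/-- The Young diagrams with at most `p` rows are the diagrams of the partitions with at most `p`
parts. -/
lemma tsum_youngDiagram (p : ℕ) (F : YoungDiagram → ℝ≥0∞)
    (hF : ∀ μ : YoungDiagram, μ.rowLen p ≠ 0 → F μ = 0) :
    ∑' μ, F μ = ∑' l : Partitions p, F l.diagram := by
  rw [Partitions.diagram_injective.tsum_eq]
  intro μ hμ
  have h0 : μ.rowLen p = 0 := by
    by_contra h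
    exact hμ (hF μ h)
  refine ⟨⟨fun i => μ.rowLen i, fun i j hij => μ.rowLen_anti i j hij⟩, ?_⟩
  apply youngDiagram_ext_rowLen
  rw [Partitions.rowLen_diagram]
  funext i
  by_cases hi : i < p
  · simp [pad, hi]
  · rw [pad_of_le _ (not_lt.mp hi)]
    have := μ.rowLen_anti p i (not_lt.mp hi)
    omega

lemma diagram_le_iff {p : ℕ} (l m : Partitions p) : m.diagram ≤ l.diagram ↔ m.1 ≤ l.1 := by
  constructor
  · intro h i
    by_contra hlt
    have h1 : ((i : ℕ), l.1 i) ∈ m.diagram := by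
      rw [m.mem_diagram, pad_coe]
      exact not_le.mp hlt
    have h2 : ((i : ℕ), l.1 i) ∈ l.diagram := h h1
    rw [l.mem_diagram, pad_coe] at h2
    exact lt_irrefl _ h2
  · rintro h ⟨i, j⟩ hm
    change (i, j) ∈ m.diagram at hm
    rw [m.mem_diagram] at hm
    rw [l.mem_diagram]
    refine hm.trans_le ?_
    by_cases hi : i < p
    · simpa [pad, hi] using h ⟨i, hi⟩
    · simp [pad, hi]

lemma tsum_partitions {p : ℕ} (F : (Fin p → ℕ) → ℝ≥0∞) :
    ∑' l : Partitions p, F l.1 =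
      ∑' l : Fin p → ℕ, (open Classical in if Antitone l then F l else 0) := by
  classical
  refine (tsum_subtype {l : Fin p → ℕ | Antitone l} F).trans (tsum_congr fun l => ?_)
  simp [Set.indicator_apply]

lemma antitone_cons_iff {p : ℕ} (c : ℕ) (l : Fin p → ℕ) :
    Antitone (Fin.cons c l : Fin (p + 1) → ℕ) ↔ pad l 0 ≤ c ∧ Antitone l := by
  constructor
  · intro h
    refine ⟨?_, fun i j hij => by simpa using h (Fin.succ_le_succ_iff.mpr hij)⟩
    cases p with
    | zero => simp [pad]
    | succ p => rw [pad_zero_eq]; simpa using h (Fin.zero_le (Fin.succ 0))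
  · rintro ⟨h0, h⟩ i j hij
    cases i using Fin.cases with
    | zero =>
      cases j using Fin.cases with
      | zero => exact le_rfl
      | succ j =>
        cases p with
        | zero => exact j.elim0
        | succ p =>
          rw [pad_zero_eq] at h0
          simpa using (h (Fin.zero_le j)).trans h0
    | succ i =>
      cases j using Fin.cases with
      | zero => exact absurd hij (by simp)
      | succ j => simpa using h (Fin.succ_le_succ_iff.mp hij)

lemma pad_le_zero {p : ℕ} {l : Fin p → ℕ} (h : Antitone l) (i : ℕ) : pad l i ≤ pad l 0 := by
  by_cases hi : i < p
  · rw [pad, pad, dif_pos hi, dif_pos (by omega)]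
    exact h (by simp [Fin.le_def])
  · simp [pad_of_le l (not_lt.mp hi)]

/-! ### Percolation as a transition between partitions -/

/-- The columns meeting the skew diagram `l / m`. -/
def skewCols (l m : ℕ → ℕ) : Set ℕ := {j | ∃ i, m i ≤ j ∧ j < l i}

lemma ncard_skewCols_cons {p : ℕ} {m : Fin (p + 1) → ℕ} (hm : Antitone m) {l : Fin p → ℕ}
    (hl : Antitone l) (w : ℕ) :
    (skewCols (pad (Fin.cons (max (m 0) (pad l 0) + w) l : Fin (p + 1) → ℕ)) (pad m)).ncard =
      (skewCols (pad l) (pad (Fin.tail m))).ncard + w := by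
  -- The columns meeting only the first row are those from `max (m 0) (l 0)` on.
  have hset : skewCols (pad (Fin.cons (max (m 0) (pad l 0) + w) l : Fin (p + 1) → ℕ)) (pad m) =
      skewCols (pad l) (pad (Fin.tail m)) ∪
        ↑(Finset.Ico (max (m 0) (pad l 0)) (max (m 0) (pad l 0) + w)) := by
    ext j
    simp only [skewCols, Set.mem_ofPred_eq, Set.mem_union, Finset.coe_Ico, Set.mem_Ico, pad_tail]
    constructor
    · rintro ⟨i, h1, h2⟩
      cases i with
      | zero =>
        rw [pad_cons_zero] at h2
        rw [pad_zero_eq] at h1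
        by_cases hj : j < pad l 0
        · refine Or.inl ⟨0, ?_, hj⟩
          have := pad_le_zero hm (0 + 1)
          rw [pad_zero_eq] at this
          omega
        · exact Or.inr ⟨by omega, h2⟩
      | succ i =>
        rw [pad_cons_succ] at h2
        exact Or.inl ⟨i, h1, h2⟩
    · rintro (⟨i, h1, h2⟩ | ⟨h1, h2⟩)
      · exact ⟨i + 1, h1, by rwa [pad_cons_succ]⟩
      · exact ⟨0, by rw [pad_zero_eq]; omega, by rwa [pad_cons_zero]⟩
  have hsub : skewCols (pad l) (pad (Fin.tail m)) ⊆ ↑(Finset.range (pad l 0)) := by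
    rintro j ⟨i, -, h2⟩
    have := pad_le_zero hl i
    simp only [Finset.coe_range, Set.mem_Iio]
    omega
  rw [hset, Set.ncard_union_eq _ ((Finset.finite_toSet _).subset hsub) (Finset.finite_toSet _),
    Set.ncard_coe_finset, Nat.card_Ico]
  · omega
  · refine Set.disjoint_left.mpr fun j hj hj' => ?_
    have h1 := hsub hj
    simp only [Finset.coe_range, Set.mem_Iio, Finset.coe_Ico, Set.mem_Ico] at h1 hj'
    omega

open Classical in
/-- A percolation step is the transition adding a skew diagram, weighted by its number of nonempty
columns. -/
lemma lppStep_eq_tsum (x : ℝ≥0∞) (p : ℕ) (f : (Fin p → ℕ) → ℝ≥0∞) {m : Fin p → ℕ}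
    (hm : Antitone m) :
    lppStep x p f m = ∑' l : Fin p → ℕ, if Antitone l ∧ m ≤ l then
      x ^ (skewCols (pad l) (pad m)).ncard * f l else 0 := by
  induction p with
  | zero =>
    rw [tsum_eq_single m (fun b hb => absurd (Subsingleton.elim b m) hb), if_pos ⟨hm, le_rfl⟩]
    have : skewCols (pad m) (pad m) = ∅ := by
      ext j; simp [skewCols, pad]
    simp [this, lppStep]
  | succ p ih =>
    have ht : Antitone (Fin.tail m) := fun i j hij => hm (Fin.succ_le_succ_iff.mpr hij)
    simp only [lppStep]
    rw [ih _ ht, tsum_fin_succ]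
    refine tsum_congr fun l => ?_
    have hiff : ∀ c : ℕ, (Antitone (Fin.cons c l : Fin (p + 1) → ℕ) ∧
        m ≤ (Fin.cons c l : Fin (p + 1) → ℕ)) ↔
        (Antitone l ∧ Fin.tail m ≤ l) ∧ max (m 0) (pad l 0) ≤ c := by
      intro c
      rw [antitone_cons_iff, Pi.le_def, Pi.le_def, Fin.forall_fin_succ, max_le_iff]
      simp only [Fin.cons_zero, Fin.cons_succ, Fin.tail]
      tauto
    simp only [hiff]
    by_cases h : Antitone l ∧ Fin.tail m ≤ l
    · simp only [h, and_self, if_true, true_and]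
      rw [tsum_ge_eq_tsum_add (max (m 0) (pad l 0)) (fun c =>
        x ^ (skewCols (pad (Fin.cons c l : Fin (p + 1) → ℕ)) (pad m)).ncard * f (Fin.cons c l)),
        ← ENNReal.tsum_mul_left]
      refine tsum_congr fun w => ?_
      rw [ncard_skewCols_cons hm h.1, pow_add, mul_assoc]
    · simp [h]

/-! ### Branching of dual Grothendieck polynomials -/

/-- The dual Grothendieck polynomial, evaluated at extended nonnegative reals. -/
noncomputable def dualEval (μ : YoungDiagram) (n : ℕ) (x : ℕ → ℝ≥0∞) : ℝ≥0∞ :=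
  ∑ π : PlanePartitionOfShape μ n, ∏ i ∈ Finset.range n, x i ^ π.1.columnCount (i + 1)

lemma PlanePartition.entry_anti (π : PlanePartition) {i i' j j' : ℕ} (hi : i ≤ i') (hj : j ≤ j') :
    π.entry i' j' ≤ π.entry i j :=
  (antitone_nat_of_succ_le (f := fun i => π.entry i j') (fun i => π.col_le i j') hi).trans
    (antitone_nat_of_succ_le (f := fun j => π.entry i j) (fun j => π.row_le i j) hj)

lemma mem_shape_iff {μ : YoungDiagram} {n : ℕ} (π : PlanePartitionOfShape μ n) (i j : ℕ) :
    (i, j) ∈ μ ↔ 0 < π.1.entry i j := by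
  have := Set.ext_iff.mp π.2.1 (i, j)
  simpa [PlanePartition.shape] using this.symm

/-- The diagram formed by the cells of a plane partition with entry at least `2`. -/
def upperShape {μ : YoungDiagram} {n : ℕ} (π : PlanePartitionOfShape μ n) : YoungDiagram where
  cells := μ.cells.filter fun c => 1 < π.1.entry c.1 c.2
  isLowerSet := by
    rintro ⟨i, j⟩ ⟨i', j'⟩ hle h
    simp only [Finset.coe_filter, Set.mem_ofPred_eq, YoungDiagram.mem_cells] at h ⊢
    have h1 := π.1.entry_anti hle.1 hle.2
    exact ⟨μ.up_left_mem hle.1 hle.2 h.1, h.2.trans_le h1⟩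

lemma mem_upperShape {μ : YoungDiagram} {n : ℕ} (π : PlanePartitionOfShape μ n) (i j : ℕ) :
    (i, j) ∈ upperShape π ↔ 1 < π.1.entry i j := by
  rw [← YoungDiagram.mem_cells]
  simp only [upperShape, Finset.mem_filter, YoungDiagram.mem_cells, and_iff_right_iff_imp]
  intro h
  rw [mem_shape_iff π]
  omega

lemma upperShape_le {μ : YoungDiagram} {n : ℕ} (π : PlanePartitionOfShape μ n) :
    upperShape π ≤ μ := Finset.filter_subset _ _

/-- Decreasing all positive entries by one. -/
def lowerEntries {μ ν : YoungDiagram} {n : ℕ} (π : PlanePartitionOfShape μ (n + 1))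
    (h : upperShape π = ν) : PlanePartitionOfShape ν n :=
  ⟨{ entry := fun i j => π.1.entry i j - 1
     finite_support := π.1.finite_support.subset fun c hc => by
       simp only [Set.mem_ofPred_eq] at hc ⊢
       omega
     col_le := fun i j => Nat.sub_le_sub_right (π.1.col_le i j) 1
     row_le := fun i j => Nat.sub_le_sub_right (π.1.row_le i j) 1 }, by
    ext ⟨i, j⟩
    rw [← h, SetLike.mem_coe, mem_upperShape]
    simp [PlanePartition.shape], fun i j => by
    have := π.2.2 i j
    simp only
    omega⟩

open Classical in
/-- Increasing by one all entries inside `μ`. -/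
noncomputable def raiseEntries (μ : YoungDiagram) {ν : YoungDiagram} {n : ℕ}
    (π : PlanePartitionOfShape ν n) : PlanePartitionOfShape μ (n + 1) :=
  ⟨{ entry := fun i j => if (i, j) ∈ μ then π.1.entry i j + 1 else 0
     finite_support := μ.cells.finite_toSet.subset fun c hc => by
       by_contra hn
       apply hc
       exact if_neg hn
     col_le := fun i j => by
       have h1 := π.1.col_le i j
       by_cases h2 : (i + 1, j) ∈ μ
       · have h3 : (i, j) ∈ μ := μ.up_left_mem (Nat.le_succ i) le_rfl h2
         simp [h2, h3, h1]
       · simp [h2]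
     row_le := fun i j => by
       have h1 := π.1.row_le i j
       by_cases h2 : (i, j + 1) ∈ μ
       · have h3 : (i, j) ∈ μ := μ.up_left_mem le_rfl (Nat.le_succ j) h2
         simp [h2, h3, h1]
       · simp [h2] }, by
    ext ⟨i, j⟩
    by_cases h2 : (i, j) ∈ μ <;> simp [PlanePartition.shape, h2], fun i j => by
    have := π.2.2 i j
    by_cases h2 : (i, j) ∈ μ
    · simpa [h2] using this
    · simp [h2]⟩

lemma upperShape_raiseEntries {μ ν : YoungDiagram} {n : ℕ} (h : ν ≤ μ)
    (π : PlanePartitionOfShape ν n) : upperShape (raiseEntries μ π) = ν := by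
  ext ⟨i, j⟩
  rw [YoungDiagram.mem_cells, YoungDiagram.mem_cells, mem_upperShape]
  by_cases h2 : (i, j) ∈ μ
  · simp [raiseEntries, h2, mem_shape_iff π]
  · have h3 : (i, j) ∉ ν := fun h4 => h2 (h h4)
    simp [raiseEntries, h2, h3]

/-- The plane partitions of shape `μ` whose cells with entries at least `2` form `ν` correspond to
the plane partitions of shape `ν`, by lowering all entries by one. -/
noncomputable def fiberEquiv {μ ν : YoungDiagram} {n : ℕ} (h : ν ≤ μ) :
    {π : PlanePartitionOfShape μ (n + 1) // upperShape π = ν} ≃ PlanePartitionOfShape ν n where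
  toFun π := lowerEntries π.1 π.2
  invFun π := ⟨raiseEntries μ π, upperShape_raiseEntries h π⟩
  left_inv := by
    rintro ⟨π, rfl⟩
    refine Subtype.ext (Subtype.ext (PlanePartition.ext ?_))
    funext i j
    have h1 := mem_shape_iff π i j
    by_cases h2 : (i, j) ∈ μ
    · have := h1.mp h2
      simp only [raiseEntries, lowerEntries, h2, if_true]
      omega
    · have : ¬ 0 < π.1.entry i j := fun h3 => h2 (h1.mpr h3)
      simp only [raiseEntries, h2, if_false]
      omega
  right_inv := by
    intro π
    refine Subtype.ext (PlanePartition.ext ?_)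
    funext i j
    by_cases h2 : (i, j) ∈ μ
    · simp [raiseEntries, lowerEntries, h2]
    · have h3 : (i, j) ∉ ν := fun h4 => h2 (h h4)
      have := (mem_shape_iff π i j).not.mp h3
      simp [raiseEntries, lowerEntries, h2]
      omega

lemma columnCount_one {μ : YoungDiagram} {n : ℕ} (π : PlanePartitionOfShape μ n) :
    π.1.columnCount 1 = (skewCols μ.rowLen (upperShape π).rowLen).ncard := by
  rw [PlanePartition.columnCount]
  congr 1
  ext j
  refine exists_congr fun i => ?_
  rw [← not_lt, ← YoungDiagram.mem_iff_lt_rowLen, ← YoungDiagram.mem_iff_lt_rowLen,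
    mem_upperShape, mem_shape_iff π]
  omega

lemma columnCount_lowerEntries {μ ν : YoungDiagram} {n : ℕ} (π : PlanePartitionOfShape μ (n + 1))
    (h : upperShape π = ν) (v : ℕ) :
    (lowerEntries π h).1.columnCount (v + 1) = π.1.columnCount (v + 1 + 1) := by
  rw [PlanePartition.columnCount, PlanePartition.columnCount]
  congr 1
  ext j
  refine exists_congr fun i => ?_
  simp only [lowerEntries]
  omega

open Classical in
/-- The branching rule of dual Grothendieck polynomials: splitting off the entries equal to `1`. -/
lemma dualEval_succ (μ : YoungDiagram) (n : ℕ) (x : ℕ → ℝ≥0∞) :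
    dualEval μ (n + 1) x = ∑' ν : YoungDiagram, if ν ≤ μ then
      x 0 ^ (skewCols μ.rowLen ν.rowLen).ncard * dualEval ν n (fun i => x (i + 1)) else 0 := by
  rw [dualEval, ← tsum_fintype (L := .unconditional _), ← (Equiv.sigmaFiberEquiv
    (upperShape : PlanePartitionOfShape μ (n + 1) → YoungDiagram)).tsum_eq, ENNReal.tsum_sigma']
  refine tsum_congr fun ν => ?_
  split_ifs with h
  · rw [dualEval, ← tsum_fintype (L := .unconditional _), ← ENNReal.tsum_mul_left,
      ← (fiberEquiv h).tsum_eq]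
    refine tsum_congr fun π => ?_
    rw [Finset.prod_range_succ', mul_comm]
    simp only [Equiv.sigmaFiberEquiv, Equiv.coe_fn_mk, zero_add, columnCount_one, π.2, fiberEquiv,
      columnCount_lowerEntries]
  · have : IsEmpty {π : PlanePartitionOfShape μ (n + 1) // upperShape π = ν} :=
      ⟨fun π => h (π.2 ▸ upperShape_le π.1)⟩
    simp

lemma dualEval_zero (μ : YoungDiagram) (x : ℕ → ℝ≥0∞) :
    dualEval μ 0 x = (open Classical in if μ = ⊥ then 1 else 0) := by
  have hz : ∀ (π : PlanePartitionOfShape μ 0) i j, π.1.entry i j = 0 :=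
    fun π i j => Nat.le_zero.mp (π.2.2 i j)
  split_ifs with h
  · subst h
    let π₀ : PlanePartitionOfShape ⊥ 0 := ⟨⟨fun _ _ => 0, by simp, by simp, by simp⟩,
      by ext; simp [PlanePartition.shape], by simp⟩
    have : Unique (PlanePartitionOfShape ⊥ 0) := ⟨⟨π₀⟩, fun π =>
      Subtype.ext (PlanePartition.ext (by funext i j; rw [hz, hz]))⟩
    simp [dualEval]
  · have : IsEmpty (PlanePartitionOfShape μ 0) := ⟨fun π => h (by
      ext ⟨i, j⟩
      rw [YoungDiagram.mem_cells, mem_shape_iff π, hz]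
      simp)⟩
    simp [dualEval]

/-- Dual Grothendieck polynomials are the weights of last-passage percolation started from the zero
boundary. -/
theorem tsum_dualEval (p n : ℕ) (x : ℕ → ℝ≥0∞) (f : (Fin p → ℕ) → ℝ≥0∞) :
    ∑' l : Partitions p, dualEval l.diagram n x * f l.1 = lppIter n x f 0 := by
  classical
  induction n generalizing x f with
  | zero =>
    have hbot : ∀ l : Partitions p, l.diagram = ⊥ ↔ l.1 = 0 := by
      intro l
      have h0 : Partitions.diagram (⟨0, fun _ _ _ => le_rfl⟩ : Partitions p) = ⊥ := by
        ext ⟨i, j⟩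
        rw [YoungDiagram.mem_cells, Partitions.mem_diagram]
        simp [pad]
      rw [← h0, Partitions.diagram_injective.eq_iff, Subtype.ext_iff]
    simp only [dualEval_zero, hbot]
    rw [tsum_partitions (fun l => (if l = 0 then 1 else 0) * f l), tsum_eq_single 0]
    · simp [lppIter, Antitone]
    · intro l hl
      simp [hl]
  | succ n ih =>
    rw [lppIter, ← ih]
    have h1 : ∀ l : Partitions p, dualEval l.diagram (n + 1) x * f l.1 =
        ∑' m : Partitions p, dualEval m.diagram n (fun i => x (i + 1)) * (if m.1 ≤ l.1 then
          x 0 ^ (skewCols (pad l.1) (pad m.1)).ncard * f l.1 else 0) := by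
      intro l
      rw [dualEval_succ, tsum_youngDiagram p, ← ENNReal.tsum_mul_right]
      · refine tsum_congr fun m => ?_
        simp only [diagram_le_iff, Partitions.rowLen_diagram]
        split_ifs
        · ring
        · simp
      · intro μ hμ
        rw [if_neg]
        intro hle
        have h2 : (p, 0) ∈ μ := by rw [YoungDiagram.mem_iff_lt_rowLen]; omega
        have h3 : (p, 0) ∈ l.diagram := hle h2
        rw [l.mem_diagram, pad_of_le _ le_rfl] at h3
        omega
    simp only [h1]
    rw [ENNReal.tsum_comm]
    refine tsum_congr fun m => ?_
    rw [ENNReal.tsum_mul_left, lppStep_eq_tsum _ _ _ m.2, tsum_partitions (fun l => if m.1 ≤ l then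
      x 0 ^ (skewCols (pad l) (pad m.1)).ncard * f l else 0)]
    simp only [ite_and]

/-! ### Branching of Schur polynomials -/

/-- The Schur polynomial, evaluated at extended nonnegative reals. -/
noncomputable def schurEval (μ : YoungDiagram) (N : ℕ) (y : ℕ → ℝ≥0∞) : ℝ≥0∞ :=
  ∑ T : BoundedTableau μ N, ∏ c ∈ μ.cells, y (T.1 c.1 c.2)

/-- The diagram formed by the cells of a tableau with entry less than `N`. -/
def smallShape {μ : YoungDiagram} {N : ℕ} (T : BoundedTableau μ (N + 1)) : YoungDiagram where
  cells := μ.cells.filter fun c => T.1 c.1 c.2 < N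
  isLowerSet := by
    rintro ⟨i, j⟩ ⟨i', j'⟩ hle h
    simp only [Finset.coe_filter, Set.mem_ofPred_eq, YoungDiagram.mem_cells] at h ⊢
    have h1 := T.1.row_weak_of_le hle.2 (μ.up_left_mem le_rfl le_rfl h.1)
    have h2 := T.1.col_weak hle.1 (μ.up_left_mem le_rfl hle.2 h.1)
    exact ⟨μ.up_left_mem hle.1 hle.2 h.1, (h2.trans h1).trans_lt h.2⟩

lemma mem_smallShape {μ : YoungDiagram} {N : ℕ} (T : BoundedTableau μ (N + 1)) (i j : ℕ) :
    (i, j) ∈ smallShape T ↔ (i, j) ∈ μ ∧ T.1 i j < N := by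
  rw [← YoungDiagram.mem_cells]
  simp [smallShape]

/-- A skew diagram is a horizontal strip when no two of its cells lie in one column. -/
lemma interlaces_rowLen_iff (ν μ : YoungDiagram) :
    Interlaces ν.rowLen μ.rowLen ↔ ν ≤ μ ∧ ∀ i j, (i + 1, j) ∈ μ → (i, j) ∈ ν := by
  constructor
  · intro h
    refine ⟨?_, fun i j hj => ?_⟩
    · rintro ⟨i, j⟩ hj
      change (i, j) ∈ ν at hj
      rw [YoungDiagram.mem_iff_lt_rowLen] at hj ⊢
      exact hj.trans_le (h i).2
    · rw [YoungDiagram.mem_iff_lt_rowLen] at hj ⊢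
      exact hj.trans_le (h i).1
  · rintro ⟨h1, h2⟩ i
    constructor
    · refine le_of_forall_lt fun j hj => ?_
      rw [← YoungDiagram.mem_iff_lt_rowLen] at hj ⊢
      exact h2 i j hj
    · refine le_of_forall_lt fun j hj => ?_
      rw [← YoungDiagram.mem_iff_lt_rowLen] at hj ⊢
      exact h1 hj

lemma interlaces_smallShape {μ : YoungDiagram} {N : ℕ} (T : BoundedTableau μ (N + 1)) :
    Interlaces (smallShape T).rowLen μ.rowLen := by
  rw [interlaces_rowLen_iff]
  refine ⟨Finset.filter_subset _ _, fun i j h => ?_⟩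
  rw [mem_smallShape]
  have h1 : T.1 i j < T.1 (i + 1) j := T.1.col_strict (Nat.lt_succ_self i) h
  have h2 : T.1 (i + 1) j < N + 1 := T.2 (i + 1, j) h
  exact ⟨μ.up_left_mem (Nat.le_succ i) le_rfl h, by omega⟩

open Classical in
/-- Removing the entries equal to `N`. -/
noncomputable def removeLargest {μ ν : YoungDiagram} {N : ℕ} (T : BoundedTableau μ (N + 1))
    (h : smallShape T = ν) : BoundedTableau ν N :=
  ⟨{ entry := fun i j => if (i, j) ∈ ν then T.1 i j else 0
     row_weak' := by
       intro i j1 j2 hj h2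
       have h1 : (i, j1) ∈ ν := ν.up_left_mem le_rfl hj.le h2
       rw [if_pos h1, if_pos h2]
       rw [← h, mem_smallShape] at h2
       exact T.1.row_weak hj h2.1
     col_strict' := by
       intro i1 i2 j hi h2
       have h1 : (i1, j) ∈ ν := ν.up_left_mem hi.le le_rfl h2
       rw [if_pos h1, if_pos h2]
       rw [← h, mem_smallShape] at h2
       exact T.1.col_strict hi h2.1
     zeros' := fun h => if_neg h }, by
    rintro ⟨i, j⟩ hc
    rw [YoungDiagram.mem_cells] at hc
    change (if (i, j) ∈ ν then T.1 i j else 0) < N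
    rw [if_pos hc]
    rw [← h, mem_smallShape] at hc
    exact hc.2⟩

open Classical in
/-- Filling the horizontal strip `μ / ν` with the entry `N`. -/
noncomputable def addLargest {μ ν : YoungDiagram} {N : ℕ} (h : Interlaces ν.rowLen μ.rowLen)
    (T : BoundedTableau ν N) : BoundedTableau μ (N + 1) :=
  ⟨{ entry := fun i j => if (i, j) ∈ ν then T.1 i j else if (i, j) ∈ μ then N else 0
     row_weak' := by
       intro i j1 j2 hj h2
       by_cases h3 : (i, j2) ∈ ν
       · rw [if_pos h3, if_pos (ν.up_left_mem le_rfl hj.le h3)]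
         exact T.1.row_weak hj h3
       · rw [if_neg h3, if_pos h2]
         split_ifs with h4
         · exact (T.2 (i, j1) h4).le
         · exact le_rfl
         · exact Nat.zero_le _
     col_strict' := by
       intro i1 i2 j hi h2
       rw [interlaces_rowLen_iff] at h
       have h1 : (i1, j) ∈ ν := h.2 i1 j (μ.up_left_mem hi le_rfl h2)
       by_cases h3 : (i2, j) ∈ ν
       · rw [if_pos h1, if_pos h3]
         exact T.1.col_strict hi h3
       · rw [if_pos h1, if_neg h3, if_pos h2]
         exact T.2 (i1, j) h1
     zeros' := by
       intro i j h2
       have h3 : (i, j) ∉ ν := fun h4 => h2 (((interlaces_rowLen_iff ν μ).mp h).1 h4)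
       rw [if_neg h3, if_neg h2] }, by
    rintro ⟨i, j⟩ hc
    change (if (i, j) ∈ ν then T.1 i j else if (i, j) ∈ μ then N else 0) < N + 1
    split_ifs with h1
    · exact (T.2 (i, j) h1).trans (Nat.lt_succ_self N)
    · exact Nat.lt_succ_self N
    · exact Nat.succ_pos N⟩

lemma removeLargest_apply {μ ν : YoungDiagram} {N : ℕ} (T : BoundedTableau μ (N + 1))
    (h : smallShape T = ν) (i j : ℕ) :
    (removeLargest T h).1 i j = (open Classical in if (i, j) ∈ ν then T.1 i j else 0) := rfl

lemma addLargest_apply {μ ν : YoungDiagram} {N : ℕ} (h : Interlaces ν.rowLen μ.rowLen)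
    (T : BoundedTableau ν N) (i j : ℕ) :
    (addLargest h T).1 i j = (open Classical in
      if (i, j) ∈ ν then T.1 i j else if (i, j) ∈ μ then N else 0) := rfl

lemma smallShape_addLargest {μ ν : YoungDiagram} {N : ℕ} (h : Interlaces ν.rowLen μ.rowLen)
    (T : BoundedTableau ν N) : smallShape (addLargest h T) = ν := by
  ext ⟨i, j⟩
  rw [YoungDiagram.mem_cells, YoungDiagram.mem_cells, mem_smallShape, addLargest_apply]
  have h1 := ((interlaces_rowLen_iff ν μ).mp h).1
  split_ifs with h2 h3
  · simpa [h2, h1 h2] using T.2 (i, j) h2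
  · simp [h2]
  · simp [h2, h3]

/-- The tableaux of shape `μ` whose entries less than `N` form `ν` correspond to the tableaux of
shape `ν` in the smaller alphabet, by removing the entries equal to `N`. -/
noncomputable def tableauFiberEquiv {μ ν : YoungDiagram} {N : ℕ}
    (h : Interlaces ν.rowLen μ.rowLen) :
    {T : BoundedTableau μ (N + 1) // smallShape T = ν} ≃ BoundedTableau ν N where
  toFun T := removeLargest T.1 T.2
  invFun T := ⟨addLargest h T, smallShape_addLargest h T⟩
  left_inv := by
    rintro ⟨T, rfl⟩
    refine Subtype.ext (Subtype.ext (SemistandardYoungTableau.ext fun i j => ?_))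
    rw [addLargest_apply, removeLargest_apply]
    split_ifs with h1 h2
    · rfl
    · have h3 : T.1 i j < N + 1 := T.2 (i, j) h2
      have h4 : ¬ T.1 i j < N := fun h4 => h1 ((mem_smallShape T i j).mpr ⟨h2, h4⟩)
      exact le_antisymm (not_lt.mp h4) (Nat.lt_succ_iff.mp h3)
    · exact (T.1.zeros h2).symm
  right_inv := by
    intro T
    refine Subtype.ext (SemistandardYoungTableau.ext fun i j => ?_)
    rw [removeLargest_apply, addLargest_apply]
    split_ifs with h1
    · rfl
    · exact (T.1.zeros h1).symm

open Classical in
/-- The branching rule of Schur polynomials: splitting off the horizontal strip of the largest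
letter. -/
lemma schurEval_succ (μ : YoungDiagram) (N : ℕ) (y : ℕ → ℝ≥0∞) :
    schurEval μ (N + 1) y = ∑' ν : YoungDiagram, if Interlaces ν.rowLen μ.rowLen then
      y N ^ (μ.card - ν.card) * schurEval ν N y else 0 := by
  rw [schurEval, ← tsum_fintype (L := .unconditional _), ← (Equiv.sigmaFiberEquiv
    (smallShape : BoundedTableau μ (N + 1) → YoungDiagram)).tsum_eq, ENNReal.tsum_sigma']
  refine tsum_congr fun ν => ?_
  split_ifs with h
  · rw [schurEval, ← tsum_fintype (L := .unconditional _), ← ENNReal.tsum_mul_left,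
      ← (tableauFiberEquiv h).symm.tsum_eq]
    refine tsum_congr fun T => ?_
    have hsub : ν.cells ⊆ μ.cells := ((interlaces_rowLen_iff ν μ).mp h).1
    change ∏ c ∈ μ.cells, y ((addLargest h T).1 c.1 c.2) = _
    rw [← Finset.prod_sdiff hsub, ← Finset.card_sdiff_of_subset hsub, ← Finset.prod_const]
    congr 1
    · refine Finset.prod_congr rfl ?_
      rintro ⟨i, j⟩ hc
      rw [Finset.mem_sdiff, YoungDiagram.mem_cells, YoungDiagram.mem_cells] at hc
      rw [addLargest_apply, if_neg hc.2, if_pos hc.1]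
    · refine Finset.prod_congr rfl ?_
      rintro ⟨i, j⟩ hc
      rw [YoungDiagram.mem_cells] at hc
      rw [addLargest_apply, if_pos hc]
  · have : IsEmpty {T : BoundedTableau μ (N + 1) // smallShape T = ν} :=
      ⟨fun T => h (T.2 ▸ interlaces_smallShape T.1)⟩
    simp

lemma card_eq_sum_rowLen (μ : YoungDiagram) (p : ℕ) (hp : μ.rowLen p = 0) :
    μ.card = ∑ i ∈ Finset.range p, μ.rowLen i := by
  rw [YoungDiagram.card, Finset.card_eq_sum_card_fiberwise (f := Prod.fst) (t := Finset.range p)]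
  · exact Finset.sum_congr rfl fun i _ => by rw [YoungDiagram.rowLen_eq_card]; rfl
  · rintro ⟨i, j⟩ hc
    have hc' : (i, j) ∈ μ := hc
    rw [YoungDiagram.mem_iff_lt_rowLen] at hc'
    simp only [Finset.coe_range, Set.mem_Iio]
    by_contra hi
    have := μ.rowLen_anti p i (not_lt.mp hi)
    omega

lemma Partitions.card_diagram {p : ℕ} (l : Partitions p) : l.diagram.card = ∑ i, l.1 i := by
  rw [card_eq_sum_rowLen _ p, l.rowLen_diagram, sum_range_pad]
  rw [l.rowLen_diagram, pad_of_le _ le_rfl]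

open Classical in
/-- The evaluation of the Schur polynomial of a sequence of row lengths; it is set to `0` when the
sequence is not a partition. -/
noncomputable def schurRow {p : ℕ} (u : Fin p → ℕ) (N : ℕ) (y : ℕ → ℝ≥0∞) : ℝ≥0∞ :=
  if h : Antitone u then schurEval (Partitions.diagram ⟨u, h⟩) N y else 0

lemma antitone_of_interlaces {p q : ℕ} {u : Fin p → ℕ} {v : Fin q → ℕ}
    (h : Interlaces (pad u) (pad v)) : Antitone u ∧ Antitone v := by
  have h1 : Antitone (pad u) := antitone_nat_of_succ_le fun i => (h (i + 1)).2.trans (h i).1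
  have h2 : Antitone (pad v) := antitone_nat_of_succ_le fun i => (h i).1.trans (h i).2
  exact ⟨fun i j hij => by simpa using h1 (Fin.le_def.mp hij),
    fun i j hij => by simpa using h2 (Fin.le_def.mp hij)⟩

open Classical in
lemma schurRow_succ {p : ℕ} (u : Fin p → ℕ) (N : ℕ) (y : ℕ → ℝ≥0∞) :
    schurRow u (N + 1) y = ∑' v : Fin p → ℕ, if Interlaces (pad v) (pad u) then
      y N ^ (∑ i, u i - ∑ i, v i) * schurRow v N y else 0 := by
  by_cases hu : Antitone u
  · rw [schurRow, dif_pos hu, schurEval_succ, tsum_youngDiagram p]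
    · have h1 : ∀ v : Partitions p, (if Interlaces v.diagram.rowLen
          (Partitions.diagram ⟨u, hu⟩).rowLen then y N ^ ((Partitions.diagram ⟨u, hu⟩).card -
          v.diagram.card) * schurEval v.diagram N y else 0) =
          (fun v : Fin p → ℕ => if Interlaces (pad v) (pad u) then
            y N ^ (∑ i, u i - ∑ i, v i) * schurRow v N y else 0) v.1 := by
        rintro ⟨v, hv⟩
        rw [Partitions.rowLen_diagram, Partitions.rowLen_diagram, Partitions.card_diagram,
          Partitions.card_diagram]
        simp only [schurRow, hv, dif_pos]
      rw [tsum_congr h1, tsum_partitions (fun v : Fin p → ℕ => if Interlaces (pad v) (pad u) then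
            y N ^ (∑ i, u i - ∑ i, v i) * schurRow v N y else 0)]
      refine tsum_congr fun v => ?_
      by_cases hv : Antitone v
      · rw [if_pos hv]
      · rw [if_neg hv, if_neg fun h => hv (antitone_of_interlaces h).1]
    · intro ν hν
      rw [if_neg]
      intro h
      have := (h p).2
      rw [Partitions.rowLen_diagram, pad_of_le _ le_rfl] at this
      omega
  · rw [schurRow, dif_neg hu]
    refine (ENNReal.tsum_eq_zero.mpr fun v => ?_).symm
    rw [if_neg fun h => hu (antitone_of_interlaces h).2]

lemma antitone_pad_iff {p : ℕ} (u : Fin p → ℕ) : Antitone (pad u) ↔ Antitone u := by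
  constructor
  · intro h i j hij
    simpa using h (Fin.le_def.mp hij)
  · intro h
    refine antitone_nat_of_succ_le fun i => ?_
    by_cases hi : i + 1 < p
    · rw [pad, pad, dif_pos hi, dif_pos (by omega)]
      exact h (by simp [Fin.le_def])
    · simp [pad_of_le u (not_lt.mp hi)]

lemma schurRow_congr {p q : ℕ} {u : Fin p → ℕ} {v : Fin q → ℕ} (h : pad u = pad v) (N : ℕ)
    (y : ℕ → ℝ≥0∞) : schurRow u N y = schurRow v N y := by
  have hiff : Antitone u ↔ Antitone v := by rw [← antitone_pad_iff, h, antitone_pad_iff]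
  by_cases hu : Antitone u
  · rw [schurRow, schurRow, dif_pos hu, dif_pos (hiff.mp hu)]
    congr 1
    apply youngDiagram_ext_rowLen
    rw [Partitions.rowLen_diagram, Partitions.rowLen_diagram, h]
  · rw [schurRow, schurRow, dif_neg hu, dif_neg (hiff.not.mp hu)]

/-- There are no tableaux with more rows than letters. -/
lemma schurEval_eq_zero (μ : YoungDiagram) (N : ℕ) (y : ℕ → ℝ≥0∞) (h : μ.rowLen N ≠ 0) :
    schurEval μ N y = 0 := by
  have hmem : (N, 0) ∈ μ := by rw [YoungDiagram.mem_iff_lt_rowLen]; omega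
  have : IsEmpty (BoundedTableau μ N) := by
    refine ⟨fun T => ?_⟩
    -- The entries of the first column increase strictly.
    have hle : ∀ i ≤ N, i ≤ T.1 i 0 := by
      intro i
      induction i with
      | zero => intros; exact Nat.zero_le _
      | succ i ih =>
        intro hi
        exact (ih (by omega)).trans_lt
          (T.1.col_strict (Nat.lt_succ_self i) (μ.up_left_mem hi le_rfl hmem))
    exact absurd (T.2 (N, 0) hmem) (not_lt.mpr (hle N le_rfl))
  simp [schurEval]

lemma schurRow_eq_zero {p : ℕ} (u : Fin p → ℕ) (N : ℕ) (y : ℕ → ℝ≥0∞) (h : pad u N ≠ 0) :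
    schurRow u N y = 0 := by
  rw [schurRow]
  split_ifs with hu
  · exact schurEval_eq_zero _ _ _ (by rwa [Partitions.rowLen_diagram])
  · rfl

lemma schurEval_bot (N : ℕ) (y : ℕ → ℝ≥0∞) : schurEval ⊥ N y = 1 := by
  let T₀ : BoundedTableau ⊥ N := ⟨⟨fun _ _ => 0, by simp, by simp, by simp⟩, by simp⟩
  have : Unique (BoundedTableau ⊥ N) := ⟨⟨T₀⟩, fun T =>
    Subtype.ext (SemistandardYoungTableau.ext fun _ _ =>
      T.1.zeros (YoungDiagram.notMem_bot _))⟩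
  simp [schurEval]

lemma pad_snoc_zero {p : ℕ} (v : Fin p → ℕ) :
    pad (Fin.snoc v 0 : Fin (p + 1) → ℕ) = pad v := by
  funext i
  rcases lt_trichotomy i p with h | h | h
  · rw [pad, pad, dif_pos (by omega), dif_pos h]
    exact Fin.snoc_castSucc (α := fun _ => ℕ) 0 v ⟨i, h⟩
  · subst h
    rw [pad_of_le v le_rfl, pad, dif_pos (by omega)]
    exact Fin.snoc_last (α := fun _ => ℕ) 0 v
  · rw [pad_of_le _ (by omega), pad_of_le _ (by omega)]

/-- Semistandard tableaux in the alphabet `{0, …, p - 1}` are Gelfand–Tsetlin patterns. -/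
lemma schurRow_eq_gtSum (p : ℕ) (u : Fin p → ℕ) (y : ℕ → ℝ≥0∞) (hy : ∀ i < p, y i = 1) :
    schurRow u p y = gtSum p (fun _ => 1) u := by
  classical
  induction p with
  | zero =>
    have hu : Antitone u := fun i => i.elim0
    have h0 : Partitions.diagram ⟨u, hu⟩ = ⊥ := by
      ext ⟨i, j⟩
      rw [YoungDiagram.mem_cells, Partitions.mem_diagram]
      simp [pad]
    rw [schurRow, dif_pos hu, h0, schurEval_bot, gtSum]
  | succ p ih =>
    rw [schurRow_succ, gtSum]
    have hinj : Function.Injective (fun v : Fin p → ℕ => (Fin.snoc v 0 : Fin (p + 1) → ℕ)) := by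
      intro v w h
      apply pad_injective
      rw [← pad_snoc_zero v, ← pad_snoc_zero w]
      exact congrArg pad h
    rw [← hinj.tsum_eq]
    · refine tsum_congr fun v => ?_
      rw [hy p (Nat.lt_succ_self p), one_pow, one_mul, pad_snoc_zero,
        schurRow_congr (pad_snoc_zero v), ih _ fun i hi => hy i (hi.trans (Nat.lt_succ_self p))]
    · intro v hv
      refine ⟨Fin.init v, ?_⟩
      have hlast : v (Fin.last p) = 0 := by
        by_contra h
        apply hv
        have : pad v p ≠ 0 := by rwa [← pad_coe v (Fin.last p)] at h
        simp [schurRow_eq_zero v p y this]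
      change Fin.snoc (Fin.init v) 0 = v
      rw [← hlast, Fin.snoc_init_self]

/-! ### Complements in a rectangle -/

/-- The complement of a partition in the rectangle with rows of length `a`, rotated to be a
partition again. It is meaningful for sequences with entries at most `a`. -/
def complement (a : ℕ) {p : ℕ} (u : Fin p → ℕ) : Fin p → ℕ := fun i => a - u i.rev

lemma complement_le (a : ℕ) {p : ℕ} (u : Fin p → ℕ) (i : Fin p) : complement a u i ≤ a :=
  Nat.sub_le _ _

lemma complement_complement (a : ℕ) {p : ℕ} (u : Fin p → ℕ) (hu : ∀ i, u i ≤ a) :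
    complement a (complement a u) = u := by
  funext i
  have := hu i
  simp only [complement, Fin.rev_rev]
  omega

lemma sum_complement (a : ℕ) {p : ℕ} (u : Fin p → ℕ) (hu : ∀ i, u i ≤ a) :
    ∑ i, complement a u i + ∑ i, u i = p * a := by
  rw [← Equiv.sum_comp Fin.revPerm u, ← Finset.sum_add_distrib]
  have h : ∀ i, complement a u i + u (Fin.revPerm i) = a := by
    intro i
    have := hu i.rev
    simp only [complement, Fin.revPerm_apply]
    omega
  rw [Finset.sum_congr rfl fun i _ => h i]
  simp

open Classical in
lemma tsum_box_complement (a : ℕ) {p : ℕ} (F : (Fin p → ℕ) → ℝ≥0∞)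
    (hF : ∀ u, ¬ (∀ i, u i ≤ a) → F u = 0) :
    ∑' u, F u = ∑' u : Fin p → ℕ, if ∀ i, u i ≤ a then F (complement a u) else 0 := by
  rw [tsum_box_reflect (fun _ => 0) (fun _ => a) F (by simpa using hF),
    ← (Equiv.arrowCongr (Fin.revPerm (n := p)) (Equiv.refl ℕ)).tsum_eq]
  refine tsum_congr fun u => ?_
  have h1 : (∀ i : Fin p, u i.rev ≤ a) ↔ ∀ i, u i ≤ a :=
    ⟨fun h i => by simpa using h i.rev, fun h i => h _⟩
  simp [h1]
  rfl

lemma interlaces_iff_succ {p : ℕ} (u : Fin p → ℕ) (l : Fin (p + 1) → ℕ) :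
    Interlaces (pad u) (pad l) ↔ ∀ i : Fin p, l i.succ ≤ u i ∧ u i ≤ l i.castSucc := by
  rw [interlaces_iff_of_le le_rfl]
  refine forall_congr' fun i => ?_
  rw [← pad_coe l i.succ, ← pad_coe l i.castSucc]
  rfl

lemma interlaces_complement_succ (a : ℕ) {p : ℕ} (u : Fin p → ℕ) (l : Fin (p + 1) → ℕ)
    (hu : ∀ i, u i ≤ a) (hl : ∀ i, l i ≤ a) :
    Interlaces (pad (complement a u)) (pad l) ↔ Interlaces (pad u) (pad (complement a l)) := by
  rw [interlaces_iff_succ, interlaces_iff_succ, ← Fin.revPerm.forall_congr_right]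
  refine forall_congr' fun i => ?_
  simp only [complement, Fin.revPerm_apply, Fin.rev_rev, Fin.rev_succ, Fin.rev_castSucc]
  have h1 := hu i
  have h2 := hl i.rev.succ
  have h3 := hl i.rev.castSucc
  omega

lemma interlaces_iff_same {p : ℕ} (u l : Fin p → ℕ) :
    Interlaces (pad u) (pad l) ↔
      (∀ i, u i ≤ l i) ∧ ∀ i j : Fin p, (j : ℕ) = i + 1 → l j ≤ u i := by
  rw [interlaces_iff_of_le (by omega)]
  constructor
  · intro h
    refine ⟨fun i => by simpa using (h i).2, fun i j hij => ?_⟩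
    have := (h i).1
    rwa [← hij, pad_coe] at this
  · rintro ⟨h1, h2⟩ i
    refine ⟨?_, by simpa using h1 i⟩
    by_cases hi : (i : ℕ) + 1 < p
    · simpa [pad, hi] using h2 i ⟨i + 1, hi⟩ rfl
    · simp [pad_of_le l (not_lt.mp hi)]

lemma interlaces_complement (a : ℕ) {p : ℕ} (u l : Fin p → ℕ)
    (hu : ∀ i, u i ≤ a) (hl : ∀ i, l i ≤ a) :
    Interlaces (pad l) (pad (complement a u)) ↔ Interlaces (pad u) (pad (complement a l)) := by
  suffices H : ∀ u l : Fin p → ℕ, (∀ i, u i ≤ a) → (∀ i, l i ≤ a) →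
      Interlaces (pad l) (pad (complement a u)) → Interlaces (pad u) (pad (complement a l)) from
    ⟨H u l hu hl, H l u hl hu⟩
  intro u l hu hl h
  rw [interlaces_iff_same] at h ⊢
  refine ⟨fun i => ?_, fun i j hij => ?_⟩
  · have h1 := h.1 i.rev
    have h2 := hu i
    have h3 := hl i.rev
    simp only [complement, Fin.rev_rev] at h1 ⊢
    omega
  · have h1 := h.2 j.rev i.rev (by simp only [Fin.val_rev]; omega)
    have h2 := hu i
    have h3 := hl j.rev
    simp only [complement, Fin.rev_rev] at h1 ⊢
    omega

/-- Rotating a Gelfand–Tsetlin pattern inside a rectangle. -/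
lemma gtSum_complement (a p : ℕ) (l : Fin p → ℕ) (hl : ∀ i, l i ≤ a) :
    gtSum p (fun _ => 1) (complement a l) = gtSum p (fun _ => 1) l := by
  classical
  induction p with
  | zero => rfl
  | succ p ih =>
    have hle : ∀ u : Fin p → ℕ, Interlaces (pad u) (pad l) → ∀ i, u i ≤ a := by
      intro u h i
      exact (((interlaces_iff_succ u l).mp h i).2).trans (hl _)
    simp only [gtSum]
    rw [tsum_box_complement a (fun u : Fin p → ℕ =>
      if Interlaces (pad u) (pad l) then gtSum p (fun _ => 1) u else 0)]
    · refine tsum_congr fun u => ?_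
      by_cases hu : ∀ i, u i ≤ a
      · rw [if_pos hu, ih u hu]
        simp only [interlaces_complement_succ a u l hu hl]
      · rw [if_neg hu, if_neg]
        intro h
        exact hu fun i => (((interlaces_iff_succ u _).mp h i).2).trans (complement_le a l _)
    · intro u hu
      rw [if_neg fun h => hu (hle u h)]

open Classical in
/-- The function that assigns to `l` inside the rectangle with rows of length `a` the Schur
polynomial of its complement in `N` letters. -/
noncomputable def boxSchur (a p N : ℕ) (y : ℕ → ℝ≥0∞) (l : Fin p → ℕ) : ℝ≥0∞ :=
  if ∀ i, l i ≤ a then schurRow (complement a l) N y else 0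

/-- Adding a horizontal strip to a partition removes one from its complement, so a strip step adds
one letter to the Schur polynomial of the complement. -/
lemma stripStep_boxSchur (a p N : ℕ) (y : ℕ → ℝ≥0∞) :
    stripStep (y N) p (boxSchur a p N y) = boxSchur a p (N + 1) y := by
  classical
  funext m
  rw [stripStep]
  by_cases hm : ∀ i, m i ≤ a
  · rw [tsum_box_complement a, boxSchur, if_pos hm, schurRow_succ]
    · refine tsum_congr fun u => ?_
      by_cases hu : ∀ i, u i ≤ a
      · rw [if_pos hu, interlaces_complement a u m hu hm, boxSchur,
          if_pos fun i => complement_le a u i, complement_complement a u hu]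
        have h1 := sum_complement a u hu
        have h2 := sum_complement a m hm
        have h3 : ∑ i, complement a u i - ∑ i, m i = ∑ i, complement a m i - ∑ i, u i := by omega
        rw [h3]
      · rw [if_neg hu, if_neg]
        intro h
        exact hu fun i => (((interlaces_iff_same u _).mp h).1 i).trans (complement_le a m _)
    · intro u hu
      simp [boxSchur, hu]
  · rw [boxSchur, if_neg hm]
    refine ENNReal.tsum_eq_zero.mpr fun u => ?_
    by_cases h : Interlaces (pad m) (pad u)
    · have hu : ¬ ∀ i, u i ≤ a :=
        fun hu => hm fun i => (((interlaces_iff_same m u).mp h).1 i).trans (hu i)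
      simp [boxSchur, hu]
    · simp [h]

lemma stripIter_boxSchur (a p n N : ℕ) (y : ℕ → ℝ≥0∞) :
    stripIter n (fun i => y (N + i)) (boxSchur a p N y) = boxSchur a p (N + n) y := by
  induction n generalizing N with
  | zero => rfl
  | succ n ih =>
    have h := ih (N + 1)
    rw [stripIter]
    simp only [add_zero, stripStep_boxSchur]
    rw [show N + (n + 1) = N + 1 + n by omega, ← h]
    congr 1
    funext i
    congr 1
    omega

/-! ### Summation -/

open Classical in
/-- Both the bound `a` on the first entry of a partition and the pattern below it pass to the
complement. -/
lemma gtSum_le_eq_boxSchur (a p : ℕ) (y : ℕ → ℝ≥0∞) (hy : ∀ i < p + 1, y i = 1) :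
    gtSum (p + 1) (fun l => if pad l 0 ≤ a then 1 else 0) = boxSchur a (p + 1) (p + 1) y := by
  funext l
  rw [gtSum_pad_zero (p + 1) (fun c _ => if c ≤ a then 1 else 0)]
  have h1 : gtSum (p + 1) (fun _ => if pad l 0 ≤ a then (1 : ℝ≥0∞) else 0) l =
      if pad l 0 ≤ a then gtSum (p + 1) (fun _ => 1) l else 0 := by
    split_ifs
    · rfl
    · simpa using gtSum_const_mul (p + 1) 0 (fun _ => 1) l
  rw [h1, boxSchur]
  by_cases hl : ∀ i, l i ≤ a
  · rw [if_pos hl, if_pos (by rw [pad_zero_eq]; exact hl 0), schurRow_eq_gtSum _ _ y hy,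
      gtSum_complement a _ l hl]
  · rw [if_neg hl]
    split_ifs with h0
    · rw [← schurRow_eq_gtSum _ _ y hy, schurRow, dif_neg]
      intro hanti
      exact hl fun i => (by simpa using pad_le_zero hanti (i : ℕ) : l i ≤ pad l 0).trans h0
    · rfl

/-- A function of the entry with index `j` depends on the last `p` rows only; each of the `j` rows
above them contributes a geometric series. -/
lemma lppIter_pad (n p j : ℕ) (x : ℕ → ℝ≥0∞) (F : ℕ → ℝ≥0∞) :
    lppIter n x (fun l : Fin (p + j) → ℕ => F (pad l j)) 0 =
      (∏ i ∈ Finset.range n, (1 - x i)⁻¹) ^ j *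
        lppIter n x (fun l : Fin p → ℕ => F (pad l 0)) 0 := by
  induction j with
  | zero => simp
  | succ j ih =>
    have h := lppIter_tail n x (fun l : Fin (p + j) → ℕ => F (pad l j)) 0
    simp only [pad_tail] at h
    have h0 : Fin.tail (0 : Fin (p + j + 1) → ℕ) = 0 := rfl
    rw [h0, ih] at h
    rw [pow_succ', mul_assoc, ← h]
    rfl

open Classical in
/-- The summation formula over the extended nonnegative reals. -/
theorem tsum_dualEval_le (p j n a : ℕ) (x y : ℕ → ℝ≥0∞) (hy : ∀ i < p + 1, y i = 1)
    (hxy : ∀ i, y (p + 1 + i) = x i) :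
    ∑' l : Partitions (p + 1 + j), dualEval l.diagram n x * (if pad l.1 j ≤ a then 1 else 0) =
      (∏ i ∈ Finset.range n, (1 - x i)⁻¹) ^ j *
        schurEval (rect (p + 1) a).diagram (p + 1 + n) y := by
  have hx : x = fun i => y (p + 1 + i) := funext fun i => (hxy i).symm
  rw [tsum_dualEval (p + 1 + j) n x (fun l => if pad l j ≤ a then 1 else 0),
    lppIter_pad n (p + 1) j x (fun c => if c ≤ a then 1 else 0), lppIter_zero_eq,
    gtSum_le_eq_boxSchur a p y hy, hx, stripIter_boxSchur, boxSchur, if_pos (by simp)]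
  congr 1
  have h0 : complement a (0 : Fin (p + 1) → ℕ) = fun _ => a := by
    funext i; simp [complement]
  have hanti : Antitone (fun _ : Fin (p + 1) => a) := fun _ _ _ => le_rfl
  rw [h0, schurRow]
  exact dif_pos hanti

/-! ### Passage to real numbers -/

/-- The extension by zero of a sequence of real numbers to a sequence in `[0, ∞]`. -/
noncomputable def extend {n : ℕ} (q : Fin n → ℝ) (i : ℕ) : ℝ≥0∞ :=
  if h : i < n then ENNReal.ofReal (q ⟨i, h⟩) else 0

lemma extend_coe {n : ℕ} (q : Fin n → ℝ) (i : Fin n) : extend q i = ENNReal.ofReal (q i) := by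
  simp [extend]

lemma ofReal_aeval_dualGrothendieck (μ : YoungDiagram) {n : ℕ} (q : Fin n → ℝ)
    (hq : ∀ i, 0 ≤ q i) : ENNReal.ofReal (MvPolynomial.aeval q (dualGrothendieck μ n)) =
      dualEval μ n (extend q) := by
  rw [dualGrothendieck, dualEval, map_sum, ENNReal.ofReal_sum_of_nonneg]
  · refine Finset.sum_congr rfl fun π _ => ?_
    rw [map_prod, ENNReal.ofReal_prod_of_nonneg, ← Fin.prod_univ_eq_prod_range
      (fun i => extend q i ^ π.1.columnCount (i + 1))]
    · refine Finset.prod_congr rfl fun i _ => ?_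
      rw [map_pow, MvPolynomial.aeval_X, extend_coe, ENNReal.ofReal_pow (hq i)]
    · intro i _
      rw [map_pow, MvPolynomial.aeval_X]
      exact pow_nonneg (hq i) _
  · intro π _
    rw [map_prod]
    refine Finset.prod_nonneg fun i _ => ?_
    rw [map_pow, MvPolynomial.aeval_X]
    exact pow_nonneg (hq i) _

lemma aeval_dualGrothendieck_nonneg (μ : YoungDiagram) {n : ℕ} (q : Fin n → ℝ)
    (hq : ∀ i, 0 ≤ q i) : 0 ≤ MvPolynomial.aeval q (dualGrothendieck μ n) := by
  rw [dualGrothendieck, map_sum]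
  refine Finset.sum_nonneg fun π _ => ?_
  rw [map_prod]
  refine Finset.prod_nonneg fun i _ => ?_
  rw [map_pow, MvPolynomial.aeval_X]
  exact pow_nonneg (hq i) _

lemma aeval_schur_nonneg (μ : YoungDiagram) {N : ℕ} (q : Fin N → ℝ)
    (hq : ∀ i, 0 ≤ q i) : 0 ≤ MvPolynomial.aeval q (schur μ N) := by
  rw [schur, map_sum]
  refine Finset.sum_nonneg fun T _ => ?_
  rw [map_prod]
  refine Finset.prod_nonneg fun c _ => ?_
  rw [MvPolynomial.aeval_X]
  exact hq _

lemma ofReal_aeval_schur (μ : YoungDiagram) {N : ℕ} (q : Fin N → ℝ)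
    (hq : ∀ i, 0 ≤ q i) : ENNReal.ofReal (MvPolynomial.aeval q (schur μ N)) =
      schurEval μ N (extend q) := by
  rw [schur, schurEval, map_sum, ENNReal.ofReal_sum_of_nonneg]
  · refine Finset.sum_congr rfl fun T _ => ?_
    rw [map_prod, ENNReal.ofReal_prod_of_nonneg, ← Finset.prod_coe_sort μ.cells]
    · refine Finset.prod_congr rfl fun c _ => ?_
      rw [MvPolynomial.aeval_X, ← extend_coe]
    · intro i _
      rw [MvPolynomial.aeval_X]
      exact hq _
  · intro T _
    rw [map_prod]
    refine Finset.prod_nonneg fun i _ => ?_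
    rw [MvPolynomial.aeval_X]
    exact hq _

end DualGroth

theorem mainTheorem2 (m n k a : ℕ) (hk : 1 ≤ k) (hkm : k ≤ m)
    (q : Fin n → ℝ) (hq : ∀ i, 0 < q i ∧ q i < 1) :
    HasSum
      (fun l : {l : DualGroth.Partitions m // l.1 ⟨k - 1, by omega⟩ ≤ a} =>
        MvPolynomial.aeval q (DualGroth.dualGrothendieck l.1.diagram n))
      ((∏ i, (1 - q i) ^ (1 - (k : ℤ))) *
        MvPolynomial.aeval (Fin.append (fun _ : Fin (m - k + 1) => (1 : ℝ)) q)
          (DualGroth.schur (DualGroth.rect (m - k + 1) a).diagram (m - k + 1 + n))) := by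
  classical
  open DualGroth in
  have hq0 : ∀ i, 0 ≤ q i := fun i => (hq i).1.le
  set y : Fin (m - k + 1 + n) → ℝ := Fin.append (fun _ : Fin (m - k + 1) => (1 : ℝ)) q with hy
  have hy0 : ∀ i, 0 ≤ y i := by
    intro i
    refine Fin.addCases (fun i => ?_) (fun i => ?_) i
    · rw [hy, Fin.append_left]; exact zero_le_one
    · rw [hy, Fin.append_right]; exact hq0 i
  have hy1 : ∀ i < m - k + 1, extend y i = 1 := by
    intro i hi
    have := extend_coe y (Fin.castAdd n ⟨i, hi⟩)
    rw [hy, Fin.append_left, ENNReal.ofReal_one] at this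
    exact this
  have hy2 : ∀ i, extend y (m - k + 1 + i) = extend q i := by
    intro i
    by_cases hi : i < n
    · have := extend_coe y (Fin.natAdd (m - k + 1) ⟨i, hi⟩)
      rw [hy, Fin.append_right, ← extend_coe] at this
      exact this
    · simp [extend, hi]
  have hsum := tsum_dualEval_le (m - k) (k - 1) n a (extend q) (extend y) hy1 hy2
  rw [show m - k + 1 + (k - 1) = m by omega] at hsum
  have hfac : (∏ i ∈ Finset.range n, (1 - extend q i)⁻¹) ^ (k - 1) =
      ENNReal.ofReal (∏ i, (1 - q i) ^ (1 - (k : ℤ))) := by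
    rw [ENNReal.ofReal_prod_of_nonneg fun i _ => zpow_nonneg (by linarith [(hq i).2]) _,
      ← Finset.prod_pow, ← Fin.prod_univ_eq_prod_range (fun i => (1 - extend q i)⁻¹ ^ (k - 1))]
    refine Finset.prod_congr rfl fun i _ => ?_
    have h1 : 0 < 1 - q i := by linarith [(hq i).2]
    rw [extend_coe, ← ENNReal.ofReal_one, ← ENNReal.ofReal_sub _ (hq0 i),
      ← ENNReal.ofReal_inv_of_pos h1, ← ENNReal.ofReal_pow (inv_nonneg.mpr h1.le),
      show (1 - (k : ℤ)) = -((k - 1 : ℕ) : ℤ) by omega, zpow_neg, zpow_natCast, inv_pow]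
  rw [hfac, ← ofReal_aeval_schur _ y hy0, ← ENNReal.ofReal_mul
    (Finset.prod_nonneg fun i _ => zpow_nonneg (by linarith [(hq i).2]) _)] at hsum
  have hind : ∑' l : {l : Partitions m // l.1 ⟨k - 1, by omega⟩ ≤ a},
      ENNReal.ofReal (MvPolynomial.aeval q (dualGrothendieck l.1.diagram n)) =
      ∑' l : Partitions m, dualEval l.diagram n (extend q) *
        (if pad l.1 (k - 1) ≤ a then 1 else 0) := by
    refine (tsum_subtype {l : Partitions m | l.1 ⟨k - 1, by omega⟩ ≤ a} (fun l =>
      ENNReal.ofReal (MvPolynomial.aeval q (dualGrothendieck l.diagram n)))).trans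
      (tsum_congr fun l => ?_)
    rw [Set.indicator_apply, ofReal_aeval_dualGrothendieck _ q hq0, pad, dif_pos (by omega)]
    simp
  rw [← hind] at hsum
  have hne := hsum ▸ ENNReal.ofReal_ne_top
  have hfin := ENNReal.hasSum_toReal hne
  rw [← ENNReal.tsum_toReal_eq fun _ => ENNReal.ofReal_ne_top, hsum, ENNReal.toReal_ofReal
    (mul_nonneg (Finset.prod_nonneg fun i _ => zpow_nonneg (by linarith [(hq i).2]) _)
      (aeval_schur_nonneg _ y hy0))] at hfin
  convert hfin using 1
  funext l
  rw [ENNReal.toReal_ofReal (aeval_dualGrothendieck_nonneg _ q hq0)]
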